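/- Let $a,b,c\ge 2$ be integers such that the triple $(a,b,c)$ is hyperbolic, i.e. $1-\frac1a-\frac1b-\frac1c>0$, and let $$\Delta(a,b,c)=\langle \delta_a,\delta_b,\delta_c \mid \delta_a^a=\delta_b^b=\delta_c^c=\delta_c\delta_b\delta_a=1\rangle$$ be the associated triangle group. Put $$\lambda=\frac{\cos(\pi/a)\cos(\pi/b)+\cos(\pi/c)}{\sin(\pi/a)\sin(\pi/b)},\qquad \mu=\lambda+\sqrt{\lambda^2-1},$$ $$x_c=\frac{\mu^2-1}{2\left(\cot(\pi/a)+\mu\cot(\pi/b)\right)},\qquad z_c=x_c+i\sqrt{\csc^2(\pi/a)-\left(x_c-\cot(\pi/a)\right)^2}.$$ These expressions are well defined and $z_c$ lies in the upper half-plane $\mathcal H$: $\lambda>1$, $\cot(\pi/a)+\mu\cot(\pi/b)>0$, and the number under the last square root is positive. There is an embedding (an injective group homomorphism) $\Delta(a,b,c)\hookrightarrow \mathrm{PSL}_2(\mathbb R)$ that sends $\delta_a$ and $\delta_b$ to the classes of $$\begin{pmatrix}\cos(\pi/a)&\sin(\pi/a)\\-\sin(\pi/a)&\cos(\pi/a)\end{pmatrix}\quad\text{and}\quad\begin{pmatrix}\cos(\pi/b)&\mu\sin(\pi/b)\\-\sin(\pi/b)/\mu&\cos(\pi/b)\end{pmatrix}$$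 respectively. In this embedding, with $\mathrm{PSL}_2(\mathbb R)$ acting on $\mathcal H$ by linear fractional transformations, $\delta_a,\delta_b,\delta_c$ each have exactly one fixed point in $\mathcal H$, namely $z_a=i$, $z_b=\mu i$ and $z_c$, respectively. Moreover $z_c$ is an algebraic number. -/

import Mathlib

open scoped MatrixGroups UpperHalfPlane

/-- A triple of (finite) integers `a, b, c ≥ 2` is hyperbolic if
`χ(a,b,c) = 1 - 1/a - 1/b - 1/c` is positive. -/
def IsHyperbolicTriple (a b c : ℕ) : Prop :=
  2 ≤ a ∧ 2 ≤ b ∧ 2 ≤ c ∧ 0 < (1 : ℚ) - 1 / (a : ℚ) - 1 / (b : ℚ) - 1 / (c : ℚ)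

/-- The three generators `δ_a, δ_b, δ_c` of the triangle group. -/
inductive TriangleGen : Type
  | a
  | b
  | c

/-- The relators of the triangle group: `δ_a ^ a`, `δ_b ^ b`, `δ_c ^ c`, `δ_c δ_b δ_a`. -/
def triangleRels (a b c : ℕ) : Set (FreeGroup TriangleGen) :=
  {FreeGroup.of TriangleGen.a ^ a,
   FreeGroup.of TriangleGen.b ^ b,
   FreeGroup.of TriangleGen.c ^ c,
   FreeGroup.of TriangleGen.c * FreeGroup.of TriangleGen.b * FreeGroup.of TriangleGen.a}

/-- The triangle group
`Δ(a,b,c) = ⟨δ_a, δ_b, δ_c | δ_a ^ a = δ_b ^ b = δ_c ^ c = δ_c δ_b δ_a = 1⟩`. -/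
abbrev TriangleGroup (a b c : ℕ) : Type := PresentedGroup (triangleRels a b c)

/-- The generator `δ_s` of `Δ(a,b,c)`, for `s` one of the three labels. -/
def triangleDelta (a b c : ℕ) (s : TriangleGen) : TriangleGroup a b c :=
  PresentedGroup.of s

/-- `λ = (cos(π/a) cos(π/b) + cos(π/c)) / (sin(π/a) sin(π/b))`. -/
noncomputable def triangleLam (a b c : ℕ) : ℝ :=
  (Real.cos (Real.pi / a) * Real.cos (Real.pi / b) + Real.cos (Real.pi / c)) /
    (Real.sin (Real.pi / a) * Real.sin (Real.pi / b))

/-- `μ = λ + √(λ² - 1)`. -/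
noncomputable def triangleMu (a b c : ℕ) : ℝ :=
  triangleLam a b c + Real.sqrt (triangleLam a b c ^ 2 - 1)

/-- The real part `(μ² - 1) / (2 (cot(π/a) + μ cot(π/b)))` of `z_c`. -/
noncomputable def triangleZcRe (a b c : ℕ) : ℝ :=
  (triangleMu a b c ^ 2 - 1) /
    (2 * (Real.cot (Real.pi / a) + triangleMu a b c * Real.cot (Real.pi / b)))

/-- The quantity `csc²(π/a) - (Re z_c - cot(π/a))²`, whose square root is the imaginary part
of `z_c`. -/
noncomputable def triangleZcImSq (a b c : ℕ) : ℝ :=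
  (1 / Real.sin (Real.pi / a)) ^ 2 - (triangleZcRe a b c - Real.cot (Real.pi / a)) ^ 2

/-- The point `z_c`. -/
noncomputable def triangleZc (a b c : ℕ) : ℂ :=
  (triangleZcRe a b c : ℂ) + Complex.I * ((Real.sqrt (triangleZcImSq a b c) : ℝ) : ℂ)

/-- `g ∈ PSL₂(ℝ)` is the class of the matrix `M` (in particular `M` has determinant one). -/
def IsClassOfMatrix (g : PSL(2, ℝ)) (M : Matrix (Fin 2) (Fin 2) ℝ) : Prop :=
  ∃ S : SL(2, ℝ), (S : Matrix (Fin 2) (Fin 2) ℝ) = M ∧ (QuotientGroup.mk S : PSL(2, ℝ)) = g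

/-- The set of fixed points in the upper half-plane (as a set of complex numbers) of an element of
`PSL₂(ℝ)` acting by linear fractional transformations. -/
def pslFixedPoints (g : PSL(2, ℝ)) : Set ℂ :=
  {w : ℂ | ∃ z : ℍ, (z : ℂ) = w ∧ Matrix.ProjectiveSpecialLinearGroup.toPGL g • z = z}

/-- The action used in `pslFixedPoints` is the action of `SL₂(ℝ)` by linear fractional
transformations. -/
theorem toPGL_mk_smul (S : SL(2, ℝ)) (z : ℍ) :
    Matrix.ProjectiveSpecialLinearGroup.toPGL (QuotientGroup.mk S : PSL(2, ℝ)) • z = S • z := by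
  rfl

/-! The images of the generators are products of two reflections in the sides of the hyperbolic
triangle with angles `π/a, π/b, π/c`. The sides are encoded by trace-zero matrices `X₀, X₁, X₂`
(`triangleReflection`) with `Xᵢ² = 1` and `XᵢXⱼ + XⱼXᵢ = -2cos(π/mᵢⱼ)`; for the pair `1, 2` this is
exactly what the choice of `μ` achieves. Hence `-XᵢXⱼ` lies in SL₂(ℝ) and has `mᵢⱼ`-th power `-1`,
so `δ_a, δ_b, δ_c ↦ -X₀X₁, -X₂X₀, -X₁X₂` defines a homomorphism to PSL₂(ℝ).

Injectivity is proved algebraically, with no fundamental domain. The triangle group embeds in the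
Coxeter group with entries `a, b, c` (`toCoxeter_injective`). That group acts on 2×2 matrices by `Y
↦ -XᵢYXᵢ`, and on the `Xᵢ` these maps obey the formulas of the geometric representation. Tits's
argument makes the action faithful as soon as some functional is positive on all `Xᵢ`; linear
independence is not needed. Conjugation by the image of a triangle group element is this action
restricted to the triangle group, so an element with trivial image is trivial.

The fixed points are roots of explicit real quadratics, and `z_c` is algebraic because sines and
cosines of rational multiples of `π` are. -/

/-! ### Tits's faithfulness argument for Coxeter groups -/

namespace CoxeterSystem

variable {B W V : Type*} [Group W] {M : CoxeterMatrix B} (cs : CoxeterSystem M W)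
  [AddCommGroup V] [Module ℝ V]

/-- Action of an alternating word on a root in a representation given by the usual reflection
formulas. -/
theorem sin_smul_alternatingWord_root (ρ : W →* Module.End ℝ V) (α : B → V)
    (hρ : ∀ s t, ρ (cs.simple t) (α s) = α s + (2 * Real.cos (Real.pi / M s t)) • α t)
    (s t : B) (k : ℕ) :
    Real.sin (Real.pi / M s t) • ρ (cs.wordProd (alternatingWord s t k)) (α s) =
      if Even k then Real.sin ((k + 1) * (Real.pi / M s t)) • α s +
        Real.sin (k * (Real.pi / M s t)) • α t
      else Real.sin (k * (Real.pi / M s t)) • α s +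
        Real.sin ((k + 1) * (Real.pi / M s t)) • α t := by
  have hself : ∀ s, ρ (cs.simple s) (α s) = -α s := by
    intro s
    rw [hρ, M.diagonal]
    simp only [Nat.cast_one, div_one, Real.cos_pi]
    module
  have hst := hρ s t
  have hts := hρ t s
  rw [M.symmetric t s] at hts
  set θ := Real.pi / M s t
  -- The coefficients are `sin(kθ)/sin θ`, governed by the Chebyshev recurrence. Keeping the factor
  -- `sin θ` on the left avoids any division.
  have key : ∀ k : ℕ, Real.sin (((k + 1 : ℕ) + 1) * θ) =
      2 * Real.cos θ * Real.sin ((k + 1) * θ) - Real.sin (k * θ) := by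
    intro k
    have h1 : (((k + 1 : ℕ) : ℝ) + 1) * θ = (k + 1) * θ + θ := by push_cast; ring
    have h2 : (k : ℝ) * θ = (k + 1) * θ - θ := by ring
    rw [h1, h2, Real.sin_add, Real.sin_sub]
    ring
  induction k with
  | zero => simp [alternatingWord]
  | succ k ih =>
    rw [alternatingWord_succ', wordProd_cons, map_mul, Module.End.mul_apply, ← map_smul, ih, key]
    by_cases hk : Even k
    · have hk' : ¬ Even (k + 1) := by simp [hk, parity_simps]
      simp only [hk, hk', if_true, if_false, map_add, map_smul, hself, hst]
      push_cast
      module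
    · have hk' : Even (k + 1) := by simp [hk, parity_simps]
      simp only [hk, hk', if_true, if_false, map_add, map_smul, hself, hts]
      push_cast
      module

/-- If `s` is not a right descent of `w ≠ 1`, then `w` factors as `v * u` with `u` a nontrivial
alternating word in `s` and another letter `t`, shorter than the braid word, and with neither `s`
nor `t` a right descent of `v`. -/
theorem exists_dihedral_factorization (hM : ∀ s t, M s t ≠ 0) {w : W} (hw : w ≠ 1) {s : B}
    (hs : ¬ cs.IsRightDescent w s) :
    ∃ (t : B) (k : ℕ) (v : W), s ≠ t ∧ 0 < k ∧ k < M s t ∧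
      w = v * cs.wordProd (alternatingWord s t k) ∧ cs.length v < cs.length w ∧
      ¬ cs.IsRightDescent v s ∧ ¬ cs.IsRightDescent v t := by
  obtain ⟨t, ht⟩ := cs.exists_rightDescent_of_ne_one hw
  have hst : s ≠ t := by rintro rfl; exact hs ht
  let v : ℕ → W := fun j => w * (cs.wordProd (alternatingWord s t j))⁻¹
  have hv : ∀ j, v j * cs.wordProd (alternatingWord s t j) = w := fun j => by simp [v]
  have hlen : ∀ j, cs.length (cs.wordProd (alternatingWord s t j)) ≤ j := fun j => by
    simpa using cs.length_wordProd_le (alternatingWord s t j)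
  have hlow : ∀ j, cs.length w ≤ cs.length (v j) + j := fun j => by
    have h := cs.length_mul_le (v j) (cs.wordProd (alternatingWord s t j))
    rw [hv] at h
    have := hlen j
    lia
  have hstep : ∀ j, v (j + 1) = v j * cs.simple (if Even j then t else s) := fun j => by
    simp [v, alternatingWord_succ', wordProd_cons, mul_assoc]
  have hup : ∀ j i, cs.length (v j) ≤ cs.length (v (j + i)) + i := by
    intro j i
    induction i with
    | zero => simp
    | succ i ih =>
      have h := cs.length_mul_simple (v (j + i)) (if Even (j + i) then t else s)
      rw [← hstep] at h
      rw [← add_assoc]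
      lia
  -- `P j` says that stripping the alternating word of length `j` shortens `w` by exactly `j`. The
  -- required `k` is the largest such `j`.
  let P : ℕ → Prop := fun j => cs.length (v j) + j = cs.length w
  classical
  have hP1 : P 1 := by
    have := cs.isRightDescent_iff.1 ht
    simpa [P, v, alternatingWord] using this
  have h1w : 1 ≤ cs.length w := by have : cs.length (v 1) + 1 = cs.length w := hP1; lia
  obtain ⟨k, hk⟩ : ∃ k, k = Nat.findGreatest P (cs.length w) := ⟨_, rfl⟩
  have hPk : P k := hk ▸ Nat.findGreatest_spec h1w hP1
  have hk1 : 1 ≤ k := hk ▸ Nat.le_findGreatest h1w hP1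
  have hPk' : ¬ P (k + 1) := by
    intro h
    have hle : k + 1 ≤ cs.length w := by
      have : cs.length (v (k + 1)) + (k + 1) = cs.length w := h
      lia
    have := Nat.le_findGreatest hle h
    lia
  have hPj : ∀ j ≤ k, P j := by
    intro j hj
    obtain ⟨i, rfl⟩ := Nat.exists_eq_add_of_le hj
    have h1 := hup j i
    have h2 := hlow j
    have h3 : cs.length (v (j + i)) + (j + i) = cs.length w := hPk
    show cs.length (v j) + j = cs.length w
    lia
  -- The next letter to strip is not a descent, by maximality of `k`; the letter stripped last is
  -- not one either, since putting it back lengthens `v k`.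
  have hd1 : ¬ cs.IsRightDescent (v k) (if Even k then t else s) := by
    intro h
    rw [isRightDescent_iff, ← hstep] at h
    apply hPk'
    have h3 : cs.length (v k) + k = cs.length w := hPk
    show cs.length (v (k + 1)) + (k + 1) = cs.length w
    lia
  have hd2 : ¬ cs.IsRightDescent (v k) (if Even k then s else t) := by
    obtain ⟨j, rfl⟩ := Nat.exists_eq_add_of_le' hk1
    have h1 : v (j + 1) * cs.simple (if Even (j + 1) then s else t) = v j := by
      rw [hstep]
      by_cases hj : Even j <;> simp [hj, parity_simps]
    rw [not_isRightDescent_iff, h1]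
    have h3 : cs.length (v (j + 1)) + (j + 1) = cs.length w := hPk
    have h4 : cs.length (v j) + j = cs.length w := hPj j (by lia)
    lia
  refine ⟨t, k, v k, hst, hk1, ?_, (hv k).symm, ?_, ?_, ?_⟩
  -- If `k` reached `M s t`, the braid relation would let the stripped word end in `s`, making `s` a
  -- right descent of `w`.
  · by_contra! hm
    have h3 : cs.length (v (M s t)) + M s t = cs.length w := hPj _ hm
    obtain ⟨m, hm'⟩ := Nat.exists_eq_succ_of_ne_zero (hM s t)
    have hb := cs.wordProd_braidWord_eq s t
    have hw' := hv (M s t)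
    unfold braidWord at hb
    rw [hb, M.symmetric t s, hm', alternatingWord_succ, wordProd_concat] at hw'
    have hws : w * cs.simple s = v (M s t) * cs.wordProd (alternatingWord s t m) := by
      rw [← hw', hm']; simp [mul_assoc]
    have h4 := cs.length_mul_le (v (M s t)) (cs.wordProd (alternatingWord s t m))
    rw [← hws, cs.not_isRightDescent_iff.1 hs] at h4
    have := hlen m
    lia
  · have h3 : cs.length (v k) + k = cs.length w := hPk
    lia
  · split_ifs at hd1 hd2 <;> assumption
  · split_ifs at hd1 hd2 <;> assumption

/-- Tits's positivity argument: a functional that is positive on the simple roots is positive on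
`w α_s` whenever `s` is not a right descent of `w`. -/
theorem root_pos_of_not_isRightDescent (hM : ∀ s t, M s t ≠ 0) (ρ : W →* Module.End ℝ V) (α : B → V)
    (hρ : ∀ s t, ρ (cs.simple t) (α s) = α s + (2 * Real.cos (Real.pi / M s t)) • α t)
    (f : V →ₗ[ℝ] ℝ) (hf : ∀ s, 0 < f (α s)) (w : W) (s : B) (hs : ¬ cs.IsRightDescent w s) :
    0 < f (ρ w (α s)) := by
  induction hn : cs.length w using Nat.strong_induction_on generalizing w s with
  | _ n ih =>
    subst hn
    by_cases hw : w = 1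
    · subst hw; simpa using hf s
    obtain ⟨t, k, v, hst, hk, hkm, hwv, hlt, hvs, hvt⟩ :=
      cs.exists_dihedral_factorization hM hw hs
    have h1 := ih _ hlt v s hvs rfl
    have h2 := ih _ hlt v t hvt rfl
    have hm : 2 ≤ M s t := by
      have := hM s t
      have := M.off_diagonal s t hst
      lia
    have hm0 : (0 : ℝ) < M s t := by exact_mod_cast (by lia : 0 < M s t)
    have hθ : 0 < Real.sin (Real.pi / M s t) := by
      apply Real.sin_pos_of_pos_of_lt_pi (by positivity)
      apply div_lt_self Real.pi_pos
      exact_mod_cast (by lia : 1 < M s t)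
    -- This coefficient vanishes when `k + 1 = M s t`; strict positivity comes from the other one.
    have hp : 0 ≤ Real.sin ((k + 1) * (Real.pi / M s t)) := by
      apply Real.sin_nonneg_of_nonneg_of_le_pi (by positivity)
      rw [← mul_div_assoc, div_le_iff₀ hm0, mul_comm]
      apply mul_le_mul_of_nonneg_left _ Real.pi_pos.le
      exact_mod_cast hkm
    have hq : 0 < Real.sin (k * (Real.pi / M s t)) := by
      have : (0 : ℝ) < k := by exact_mod_cast hk
      apply Real.sin_pos_of_pos_of_lt_pi (by positivity)
      rw [← mul_div_assoc, div_lt_iff₀ hm0, mul_comm]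
      apply mul_lt_mul_of_pos_left _ Real.pi_pos
      exact_mod_cast hkm
    have key := congrArg (f ∘ₗ ρ v) (cs.sin_smul_alternatingWord_root ρ α hρ s t k)
    rw [map_smul, LinearMap.comp_apply, ← Module.End.mul_apply, ← map_mul, ← hwv,
      smul_eq_mul] at key
    refine (mul_pos_iff_of_pos_left hθ).1 ?_
    rw [key]
    split_ifs
    · simp only [map_add, map_smul, smul_eq_mul, LinearMap.comp_apply]
      positivity
    · simp only [map_add, map_smul, smul_eq_mul, LinearMap.comp_apply]
      positivity

/-- Faithfulness of a geometric representation of a Coxeter group with finite entries, provided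
that the simple roots lie in an open half-space. -/
theorem geometric_representation_injective (hM : ∀ s t, M s t ≠ 0) (ρ : W →* Module.End ℝ V)
    (α : B → V)
    (hρ : ∀ s t, ρ (cs.simple t) (α s) = α s + (2 * Real.cos (Real.pi / M s t)) • α t)
    (f : V →ₗ[ℝ] ℝ) (hf : ∀ s, 0 < f (α s)) (w : W) (hw : ρ w = 1) : w = 1 := by
  by_contra hne
  obtain ⟨s, hs⟩ := cs.exists_rightDescent_of_ne_one hne
  -- Positivity of `f` on `ρ (w s) α_s` contradicts `ρ w = 1`, which makes this vector `-α_s`.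
  have h := cs.root_pos_of_not_isRightDescent hM ρ α hρ f hf (w * cs.simple s) s
    (cs.isRightDescent_iff_not_isRightDescent_mul.1 hs)
  rw [map_mul, hw, one_mul, hρ, M.diagonal] at h
  simp only [Nat.cast_one, div_one, Real.cos_pi, map_add, map_smul, smul_eq_mul] at h
  linarith [hf s]

end CoxeterSystem

/-! ### The triangle Coxeter group -/

/-- The Coxeter matrix of the extended triangle group: the three reflections `0, 1, 2` satisfy
`(s₀ s₁) ^ a = (s₀ s₂) ^ b = (s₁ s₂) ^ c = 1`. -/
def triangleCoxeterMatrix (a b c : ℕ) (ha : 2 ≤ a) (hb : 2 ≤ b) (hc : 2 ≤ c) :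
    CoxeterMatrix (Fin 3) where
  M := !![1, a, b; a, 1, c; b, c, 1]
  isSymm := by
    ext i j
    fin_cases i <;> fin_cases j <;> rfl
  diagonal i := by fin_cases i <;> rfl
  off_diagonal i j := by
    fin_cases i <;> fin_cases j <;> simp <;> lia

theorem triangleCoxeterMatrix_ne_zero {a b c : ℕ} (ha : 2 ≤ a) (hb : 2 ≤ b) (hc : 2 ≤ c)
    (i j : Fin 3) : triangleCoxeterMatrix a b c ha hb hc i j ≠ 0 := by
  fin_cases i <;> fin_cases j <;> simp [triangleCoxeterMatrix] <;> lia

/-- To lift a family of three involutions to a triangle Coxeter group it suffices to check the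
three braid relations. -/
theorem triangleCoxeterMatrix_isLiftable {G : Type*} [Monoid G] {a b c : ℕ}
    (ha : 2 ≤ a) (hb : 2 ≤ b) (hc : 2 ≤ c) (f : Fin 3 → G) (hf : ∀ i, f i * f i = 1)
    (h01 : (f 0 * f 1) ^ a = 1) (h20 : (f 2 * f 0) ^ b = 1) (h12 : (f 1 * f 2) ^ c = 1) :
    (triangleCoxeterMatrix a b c ha hb hc).IsLiftable f := by
  have swap : ∀ (i j : Fin 3) (n : ℕ), (f i * f j) ^ n = 1 → (f j * f i) ^ n = 1 := by
    intro i j n h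
    have h2 : (f j * f i) ^ n * (f i * f j) ^ n = 1 := by
      clear h
      induction n with
      | zero => simp
      | succ n ih =>
        rw [pow_succ, pow_succ', show (f j * f i) ^ n * (f j * f i) * (f i * f j * (f i * f j) ^ n) =
          (f j * f i) ^ n * (f j * (f i * f i) * f j) * (f i * f j) ^ n by simp only [mul_assoc],
          hf, mul_one, hf, mul_one, ih]
    rwa [h, mul_one] at h2
  intro i j
  fin_cases i <;> fin_cases j <;> simp only [triangleCoxeterMatrix]
  · simpa using hf 0
  · exact h01
  · exact swap _ _ _ h20
  · exact swap _ _ _ h01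
  · simpa using hf 1
  · exact h12
  · exact h20
  · exact swap _ _ _ h12
  · simpa using hf 2

/-! ### The triangle group inside the Coxeter group -/

namespace TriangleGroup

section

variable (a b c : ℕ)

theorem delta_a_pow : triangleDelta a b c .a ^ a = 1 :=
  PresentedGroup.one_of_mem (rels := triangleRels a b c)
    (x := FreeGroup.of TriangleGen.a ^ a) (by simp [triangleRels])

theorem delta_b_pow : triangleDelta a b c .b ^ b = 1 :=
  PresentedGroup.one_of_mem (rels := triangleRels a b c)
    (x := FreeGroup.of TriangleGen.b ^ b) (by simp [triangleRels])

theorem delta_c_pow : triangleDelta a b c .c ^ c = 1 :=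
  PresentedGroup.one_of_mem (rels := triangleRels a b c)
    (x := FreeGroup.of TriangleGen.c ^ c) (by simp [triangleRels])

theorem delta_mul : triangleDelta a b c .c * triangleDelta a b c .b * triangleDelta a b c .a = 1 :=
  PresentedGroup.one_of_mem (rels := triangleRels a b c)
    (x := FreeGroup.of TriangleGen.c * FreeGroup.of TriangleGen.b * FreeGroup.of TriangleGen.a)
    (by simp [triangleRels])

end

/-- The family of images `x, y, z` of the generators. -/
def genFamily {G : Type*} (x y z : G) : TriangleGen → G
  | .a => x
  | .b => y
  | .c => z

/-- The homomorphism out of the triangle group determined by images of the generators. -/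
def lift {G : Type*} [Group G] {a b c : ℕ} (x y z : G) (hx : x ^ a = 1) (hy : y ^ b = 1)
    (hz : z ^ c = 1) (hxyz : z * y * x = 1) : TriangleGroup a b c →* G :=
  PresentedGroup.toGroup (f := genFamily x y z) (by
    intro r hr
    simp only [triangleRels, Set.mem_insert_iff, Set.mem_singleton_iff] at hr
    rcases hr with rfl | rfl | rfl | rfl <;> simp [genFamily, hx, hy, hz, hxyz])

section

variable {G : Type*} [Group G] {a b c : ℕ} (x y z : G) (hx : x ^ a = 1) (hy : y ^ b = 1)
    (hz : z ^ c = 1) (hxyz : z * y * x = 1)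

@[simp] theorem lift_delta_a : lift x y z hx hy hz hxyz (triangleDelta a b c .a) = x :=
  PresentedGroup.toGroup.of _

@[simp] theorem lift_delta_b : lift x y z hx hy hz hxyz (triangleDelta a b c .b) = y :=
  PresentedGroup.toGroup.of _

@[simp] theorem lift_delta_c : lift x y z hx hy hz hxyz (triangleDelta a b c .c) = z :=
  PresentedGroup.toGroup.of _

end

theorem hom_ext {G : Type*} [Monoid G] {a b c : ℕ} {f g : TriangleGroup a b c →* G}
    (ha : f (triangleDelta a b c .a) = g (triangleDelta a b c .a))
    (hb : f (triangleDelta a b c .b) = g (triangleDelta a b c .b)) : f = g := by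
  have key : ∀ {f : TriangleGroup a b c →* G} , f (triangleDelta a b c .c) *
      (f (triangleDelta a b c .b) * f (triangleDelta a b c .a)) = 1 ∧
      (f (triangleDelta a b c .b) * f (triangleDelta a b c .a)) * f (triangleDelta a b c .c) = 1 := by
    intro f
    have h := delta_mul a b c
    have h' := mul_eq_one_comm.1 ((mul_assoc _ _ _).symm.trans h)
    rw [mul_assoc] at h
    rw [← map_mul, ← map_mul, ← map_mul, h, h', map_one]
    exact ⟨rfl, rfl⟩
  apply MonoidHom.eq_of_eqOn_dense (PresentedGroup.closure_range_of (triangleRels a b c))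
  rintro _ ⟨s, rfl⟩
  cases s with
  | a => exact ha
  | b => exact hb
  | c =>
    have h1 := (key (f := f)).1
    have h2 := (key (f := g)).2
    rw [← ha, ← hb] at h2
    exact left_inv_eq_right_inv h1 h2

/-- The automorphism of the triangle group inverting `δ_a` and `δ_b`, as an endomorphism. -/
def flip (a b c : ℕ) : TriangleGroup a b c →* TriangleGroup a b c :=
  lift (triangleDelta a b c .a)⁻¹ (triangleDelta a b c .b)⁻¹
    (triangleDelta a b c .a * triangleDelta a b c .b)
    (by rw [inv_pow, delta_a_pow, inv_one]) (by rw [inv_pow, delta_b_pow, inv_one])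
    (by
      -- `δ_b δ_a = δ_c⁻¹`, so `δ_a δ_b` is a conjugate of `δ_c⁻¹` and has the required order
      -- relation.
      have h : triangleDelta a b c .a * triangleDelta a b c .b =
          triangleDelta a b c .a * (triangleDelta a b c .c)⁻¹ * (triangleDelta a b c .a)⁻¹ := by
        rw [eq_mul_inv_iff_mul_eq, mul_assoc, mul_right_inj, ← mul_eq_one_iff_eq_inv',
          ← mul_assoc]
        exact delta_mul a b c
      rw [h, conj_pow, inv_pow, delta_c_pow]
      simp)
    (by simp)

theorem flip_delta_a (a b c : ℕ) :
    flip a b c (triangleDelta a b c .a) = (triangleDelta a b c .a)⁻¹ := lift_delta_a ..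

theorem flip_delta_b (a b c : ℕ) :
    flip a b c (triangleDelta a b c .b) = (triangleDelta a b c .b)⁻¹ := lift_delta_b ..

theorem flip_flip (a b c : ℕ) (x : TriangleGroup a b c) : flip a b c (flip a b c x) = x := by
  have : (flip a b c).comp (flip a b c) = MonoidHom.id _ := by
    apply hom_ext <;> simp [flip_delta_a, flip_delta_b]
  exact DFunLike.congr_fun this x

/-- The involution `flip` as a permutation of the triangle group. -/
def flipPerm (a b c : ℕ) : Equiv.Perm (TriangleGroup a b c) where
  toFun := flip a b c
  invFun := flip a b c
  left_inv := flip_flip a b c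
  right_inv := flip_flip a b c

/-- Three involutions acting on the triangle group, generating its extension by `flip`. -/
def reflectionPerm (a b c : ℕ) : Fin 3 → Equiv.Perm (TriangleGroup a b c) :=
  ![flipPerm a b c, flipPerm a b c * MulAction.toPermHom _ _ (triangleDelta a b c .a),
    MulAction.toPermHom _ _ (triangleDelta a b c .b) * flipPerm a b c]

theorem flipPerm_mul_self (a b c : ℕ) : flipPerm a b c * flipPerm a b c = 1 :=
  Equiv.ext (flip_flip a b c)

theorem reflectionPerm_mul_self (a b c : ℕ) (i : Fin 3) :
    reflectionPerm a b c i * reflectionPerm a b c i = 1 := by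
  fin_cases i
  · exact flipPerm_mul_self a b c
  · ext x
    show flip a b c (triangleDelta a b c .a * flip a b c (triangleDelta a b c .a * x)) = x
    rw [map_mul, flip_flip, flip_delta_a, inv_mul_cancel_left]
  · ext x
    show triangleDelta a b c .b * flip a b c (triangleDelta a b c .b * flip a b c x) = x
    rw [map_mul, flip_flip, flip_delta_b, mul_inv_cancel_left]

theorem reflectionPerm_zero_mul_one (a b c : ℕ) : reflectionPerm a b c 0 * reflectionPerm a b c 1 =
    MulAction.toPermHom _ _ (triangleDelta a b c .a) := by
  show flipPerm a b c * (flipPerm a b c * _) = _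
  rw [← mul_assoc, flipPerm_mul_self, one_mul]

theorem reflectionPerm_two_mul_zero (a b c : ℕ) : reflectionPerm a b c 2 * reflectionPerm a b c 0 =
    MulAction.toPermHom _ _ (triangleDelta a b c .b) := by
  show _ * flipPerm a b c * flipPerm a b c = _
  rw [mul_assoc, flipPerm_mul_self, mul_one]

theorem reflectionPerm_one_mul_two (a b c : ℕ) : reflectionPerm a b c 1 * reflectionPerm a b c 2 =
    MulAction.toPermHom _ _ (triangleDelta a b c .c) := by
  have h1 : reflectionPerm a b c 1 * reflectionPerm a b c 2 *
      (reflectionPerm a b c 2 * reflectionPerm a b c 0) *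
      (reflectionPerm a b c 0 * reflectionPerm a b c 1) = 1 := by
    have h := reflectionPerm_mul_self a b c
    have assoc : ∀ x y z : Equiv.Perm (TriangleGroup a b c),
        x * y * (y * z) * (z * x) = x * ((y * y) * (z * z)) * x := fun x y z => by
      simp only [mul_assoc]
    rw [assoc]
    rw [h, h, mul_one, mul_one, h]
  rw [reflectionPerm_zero_mul_one, reflectionPerm_two_mul_zero] at h1
  have h2 := congrArg (MulAction.toPermHom (TriangleGroup a b c) (TriangleGroup a b c))
    (delta_mul a b c)
  rw [map_mul, map_mul, map_one] at h2
  rw [mul_assoc] at h1 h2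
  exact mul_right_cancel (h1.trans h2.symm)

variable {a b c : ℕ} (ha : 2 ≤ a) (hb : 2 ≤ b) (hc : 2 ≤ c)

/-- The map from the triangle group to the Coxeter group generated by the three reflections. -/
def toCoxeter : TriangleGroup a b c →* (triangleCoxeterMatrix a b c ha hb hc).Group :=
  let cs := (triangleCoxeterMatrix a b c ha hb hc).toCoxeterSystem
  let s := cs.simple
  lift (s 0 * s 1) (s 2 * s 0) (s 1 * s 2)
    (show (s 0 * s 1) ^ a = 1 from cs.simple_mul_simple_pow 0 1)
    (show (s 2 * s 0) ^ b = 1 from cs.simple_mul_simple_pow 2 0)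
    (show (s 1 * s 2) ^ c = 1 from cs.simple_mul_simple_pow 1 2) (by
      have assoc : s 1 * s 2 * (s 2 * s 0) * (s 0 * s 1) =
          s 1 * ((s 2 * s 2) * (s 0 * s 0)) * s 1 := by simp only [mul_assoc]
      have h : ∀ i, s i * s i = 1 := cs.simple_mul_simple_self
      rw [assoc, h, h, mul_one, mul_one, h])

theorem toCoxeter_delta_a : toCoxeter ha hb hc (triangleDelta a b c .a) =
    (triangleCoxeterMatrix a b c ha hb hc).toCoxeterSystem.simple 0 *
      (triangleCoxeterMatrix a b c ha hb hc).toCoxeterSystem.simple 1 := by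
  rw [toCoxeter, lift_delta_a]

theorem toCoxeter_delta_b : toCoxeter ha hb hc (triangleDelta a b c .b) =
    (triangleCoxeterMatrix a b c ha hb hc).toCoxeterSystem.simple 2 *
      (triangleCoxeterMatrix a b c ha hb hc).toCoxeterSystem.simple 0 := by
  rw [toCoxeter, lift_delta_b]

/-- The Coxeter group acts on the underlying set of the triangle group through `reflectionPerm`.
Pulled back along `toCoxeter`, this action is left translation, which is faithful. -/
theorem toCoxeter_injective : Function.Injective (toCoxeter ha hb hc) := by
  let cs := (triangleCoxeterMatrix a b c ha hb hc).toCoxeterSystem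
  have hl : (triangleCoxeterMatrix a b c ha hb hc).IsLiftable (reflectionPerm a b c) := by
    apply triangleCoxeterMatrix_isLiftable ha hb hc _ (reflectionPerm_mul_self a b c)
    · rw [reflectionPerm_zero_mul_one, ← map_pow, delta_a_pow, map_one]
    · rw [reflectionPerm_two_mul_zero, ← map_pow, delta_b_pow, map_one]
    · rw [reflectionPerm_one_mul_two, ← map_pow, delta_c_pow, map_one]
  let ψ := cs.lift ⟨reflectionPerm a b c, hl⟩
  have hψ : ∀ i, ψ (cs.simple i) = reflectionPerm a b c i := cs.lift_apply_simple hl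
  have hcomp : ψ.comp (toCoxeter ha hb hc) =
      MulAction.toPermHom (TriangleGroup a b c) (TriangleGroup a b c) := by
    apply hom_ext
    · rw [MonoidHom.comp_apply, toCoxeter_delta_a, map_mul]
      exact (congrArg₂ _ (hψ 0) (hψ 1)).trans (reflectionPerm_zero_mul_one a b c)
    · rw [MonoidHom.comp_apply, toCoxeter_delta_b, map_mul]
      exact (congrArg₂ _ (hψ 2) (hψ 0)).trans (reflectionPerm_two_mul_zero a b c)
  have hinj : Function.Injective (MulAction.toPermHom (TriangleGroup a b c) (TriangleGroup a b c)) :=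
    MulAction.toPerm_injective
  rw [← hcomp, MonoidHom.coe_comp] at hinj
  exact Function.Injective.of_comp hinj

end TriangleGroup

/-! ### Trigonometry of the closed formulas -/

section Formulas

theorem sin_pi_div_pos {n : ℕ} (hn : 2 ≤ n) : 0 < Real.sin (Real.pi / n) := by
  have : (1 : ℝ) < n := by exact_mod_cast hn
  exact Real.sin_pos_of_pos_of_lt_pi (div_pos Real.pi_pos (by linarith))
    (div_lt_self Real.pi_pos this)

theorem pi_div_le_pi_div_two {n : ℕ} (hn : 2 ≤ n) : Real.pi / n ≤ Real.pi / 2 := by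
  have : (2 : ℝ) ≤ n := by exact_mod_cast hn
  exact div_le_div_of_nonneg_left Real.pi_pos.le two_pos this

theorem cos_pi_div_nonneg {n : ℕ} (hn : 2 ≤ n) : 0 ≤ Real.cos (Real.pi / n) := by
  apply Real.cos_nonneg_of_neg_pi_div_two_le_of_le _ (pi_div_le_pi_div_two hn)
  have : 0 ≤ Real.pi / n := by positivity
  linarith [Real.pi_pos]

theorem cos_pi_div_pos {n : ℕ} (hn : 3 ≤ n) : 0 < Real.cos (Real.pi / n) := by
  have h : (3 : ℝ) ≤ n := by exact_mod_cast hn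
  have h' : Real.pi / n ≤ Real.pi / 3 := div_le_div_of_nonneg_left Real.pi_pos.le three_pos h
  apply Real.cos_pos_of_mem_Ioo
  have : 0 ≤ Real.pi / n := by positivity
  constructor <;> linarith [Real.pi_pos]

namespace IsHyperbolicTriple

variable {a b c : ℕ} (h : IsHyperbolicTriple a b c)
include h

theorem angle_sum_lt : Real.pi / a + Real.pi / b + Real.pi / c < Real.pi := by
  have h4 : (0 : ℝ) < 1 - 1 / a - 1 / b - 1 / c := by
    have := (Rat.cast_pos (K := ℝ)).2 h.2.2.2
    push_cast at this
    exact this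
  have := mul_pos Real.pi_pos h4
  have e : Real.pi * (1 - 1 / a - 1 / b - 1 / c) =
    Real.pi - (Real.pi / a + Real.pi / b + Real.pi / c) := by ring
  linarith

/-- Since `π/a + π/b < π - π/c`, monotonicity of cosine gives `cos(π/a + π/b) > -cos(π/c)`. -/
theorem one_lt_lam : 1 < triangleLam a b c := by
  obtain ⟨ha, hb, hc, -⟩ := id h
  have hs := mul_pos (sin_pi_div_pos ha) (sin_pi_div_pos hb)
  rw [triangleLam, one_lt_div hs]
  have h1 : Real.cos (Real.pi - Real.pi / c) < Real.cos (Real.pi / a + Real.pi / b) := by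
    apply Real.cos_lt_cos_of_nonneg_of_le_pi
    · positivity
    · have : 0 ≤ Real.pi / c := by positivity
      linarith
    · linarith [h.angle_sum_lt]
  rw [Real.cos_pi_sub, Real.cos_add] at h1
  linarith

theorem one_lt_mu : 1 < triangleMu a b c := by
  have := Real.sqrt_nonneg (triangleLam a b c ^ 2 - 1)
  have := h.one_lt_lam
  unfold triangleMu
  linarith

/-- `μ` is a root of `t² - 2λt + 1`; this is the cleared form of `μ + 1/μ = 2λ`. -/
theorem mu_relation : (triangleMu a b c ^ 2 + 1) * (Real.sin (Real.pi / a) * Real.sin (Real.pi / b)) =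
    2 * triangleMu a b c *
      (Real.cos (Real.pi / a) * Real.cos (Real.pi / b) + Real.cos (Real.pi / c)) := by
  obtain ⟨ha, hb, hc, -⟩ := id h
  have hs := mul_pos (sin_pi_div_pos ha) (sin_pi_div_pos hb)
  have h1 : triangleLam a b c * (Real.sin (Real.pi / a) * Real.sin (Real.pi / b)) =
      Real.cos (Real.pi / a) * Real.cos (Real.pi / b) + Real.cos (Real.pi / c) :=
    div_mul_cancel₀ _ hs.ne'
  have h2 : triangleMu a b c ^ 2 + 1 = 2 * triangleMu a b c * triangleLam a b c := by
    have h3 : 0 ≤ triangleLam a b c ^ 2 - 1 := by nlinarith [h.one_lt_lam]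
    have h4 := Real.sq_sqrt h3
    unfold triangleMu
    linear_combination h4
  rw [h2, ← h1]
  ring

/-- Both terms are nonnegative and vanish together only for `a = b = 2`, which is not hyperbolic. -/
theorem denom_pos : 0 < Real.sin (Real.pi / b) * Real.cos (Real.pi / a) +
    triangleMu a b c * (Real.sin (Real.pi / a) * Real.cos (Real.pi / b)) := by
  obtain ⟨ha, hb, hc, h4⟩ := id h
  have hμ := h.one_lt_mu
  have sa := sin_pi_div_pos ha
  have sb := sin_pi_div_pos hb
  have ca := cos_pi_div_nonneg ha
  have cb := cos_pi_div_nonneg hb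
  rcases Nat.lt_or_ge 2 a with h' | h'
  · have := cos_pi_div_pos h'
    positivity
  rcases Nat.lt_or_ge 2 b with h'' | h''
  · have := cos_pi_div_pos h''
    positivity
  obtain rfl : a = 2 := by lia
  obtain rfl : b = 2 := by lia
  have : (0 : ℚ) ≤ 1 / c := by positivity
  norm_num at h4 this
  linarith

theorem cot_eq :
    Real.cot (Real.pi / a) + triangleMu a b c * Real.cot (Real.pi / b) =
    (Real.sin (Real.pi / b) * Real.cos (Real.pi / a) +
      triangleMu a b c * (Real.sin (Real.pi / a) * Real.cos (Real.pi / b))) /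
      (Real.sin (Real.pi / a) * Real.sin (Real.pi / b)) := by
  have sa := (sin_pi_div_pos h.1).ne'
  have sb := (sin_pi_div_pos h.2.1).ne'
  rw [Real.cot_eq_cos_div_sin, Real.cot_eq_cos_div_sin]
  field_simp

theorem cot_pos : 0 < Real.cot (Real.pi / a) + triangleMu a b c * Real.cot (Real.pi / b) := by
  rw [h.cot_eq]
  exact div_pos h.denom_pos (mul_pos (sin_pi_div_pos h.1) (sin_pi_div_pos h.2.1))

theorem zcRe_relation : 2 * (Real.sin (Real.pi / b) * Real.cos (Real.pi / a) +
      triangleMu a b c * (Real.sin (Real.pi / a) * Real.cos (Real.pi / b))) * triangleZcRe a b c =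
    (triangleMu a b c ^ 2 - 1) * (Real.sin (Real.pi / a) * Real.sin (Real.pi / b)) := by
  have sa := (sin_pi_div_pos h.1).ne'
  have sb := (sin_pi_div_pos h.2.1).ne'
  have hD := h.denom_pos.ne'
  rw [triangleZcRe, h.cot_eq]
  generalize Real.sin (Real.pi / b) * Real.cos (Real.pi / a) +
    triangleMu a b c * (Real.sin (Real.pi / a) * Real.cos (Real.pi / b)) = D at hD ⊢
  field_simp

/-- The circle with centre `cot(π/a)` and radius `csc(π/a)` passes through `i`; it carries the side
joining `z_a` and `z_c`. -/
theorem zcImSq_eq_add : triangleZcImSq a b c =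
    1 + 2 * triangleZcRe a b c * (Real.cos (Real.pi / a) / Real.sin (Real.pi / a)) -
      triangleZcRe a b c ^ 2 := by
  have sa := (sin_pi_div_pos h.1).ne'
  rw [triangleZcImSq, Real.cot_eq_cos_div_sin]
  field_simp
  linear_combination -Real.sin_sq_add_cos_sq (Real.pi / a)

/-- An elliptic matrix of trace `2cos(π/c)` fixes a point of height `sin(π/c)` over the absolute
value of its lower left entry. Writing the quantity as this square makes its positivity visible. -/
theorem zcImSq_eq_sq : triangleZcImSq a b c =
    (triangleMu a b c * Real.sin (Real.pi / c) / (Real.sin (Real.pi / b) * Real.cos (Real.pi / a) +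
      triangleMu a b c * (Real.sin (Real.pi / a) * Real.cos (Real.pi / b)))) ^ 2 := by
  have hsa := (sin_pi_div_pos h.1).ne'
  have hD := h.denom_pos.ne'
  have hx := h.zcRe_relation
  have hμ := h.mu_relation
  have hA := Real.sin_sq_add_cos_sq (Real.pi / a)
  have hB := Real.sin_sq_add_cos_sq (Real.pi / b)
  have hC := Real.sin_sq_add_cos_sq (Real.pi / c)
  rw [h.zcImSq_eq_add, div_pow, eq_div_iff (pow_ne_zero 2 hD)]
  set D := Real.sin (Real.pi / b) * Real.cos (Real.pi / a) +
      triangleMu a b c * (Real.sin (Real.pi / a) * Real.cos (Real.pi / b)) with hDdef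
  generalize triangleZcRe a b c = x at *
  generalize triangleMu a b c = μ at *
  generalize Real.sin (Real.pi / a) = sa at *
  generalize Real.sin (Real.pi / b) = sb at *
  generalize Real.sin (Real.pi / c) = sc at *
  generalize Real.cos (Real.pi / a) = ca at *
  generalize Real.cos (Real.pi / b) = cb at *
  generalize Real.cos (Real.pi / c) = cc at *
  have hxa : 2 * D * x * (ca / sa) = (μ ^ 2 - 1) * (sb * ca) := by
    rw [hx]; field_simp
  -- After scaling by `4D²`, `x` enters only through `2Dx`, which `hx` evaluates.
  have e : (1 + 2 * x * (ca / sa) - x ^ 2) * D ^ 2 * 4 =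
      4 * D ^ 2 + 4 * D * (2 * D * x * (ca / sa)) - (2 * D * x) ^ 2 := by ring
  have e2 : 4 * D ^ 2 + 4 * D * ((μ ^ 2 - 1) * (sb * ca)) - ((μ ^ 2 - 1) * (sa * sb)) ^ 2 =
      4 * (μ * sc) ^ 2 := by
    rw [hDdef]
    linear_combination (4 * μ * ca * cb - ((μ ^ 2 + 1) * (sa * sb) + 2 * μ * (ca * cb + cc))) * hμ +
      4 * μ ^ 2 * ((ca ^ 2 + sa ^ 2) * hB + hA - hC)
  rw [hxa, hx, e2] at e
  linarith

theorem zcImSq_pos : 0 < triangleZcImSq a b c := by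
  rw [h.zcImSq_eq_sq]
  have := h.denom_pos
  have := sin_pi_div_pos h.2.2.1
  have := h.one_lt_mu
  positivity

end IsHyperbolicTriple

/-! ### Algebraicity -/

theorem isAlgebraic_cos_pi_div (n : ℕ) : IsAlgebraic ℚ (Real.cos (Real.pi / n)) := by
  have h := (Real.isAlgebraic_cos_rat_mul_pi (1 / n)).extendScalars (S := ℚ) (algebraMap ℤ ℚ).injective_int
  push_cast at h
  rwa [one_div_mul_eq_div] at h

theorem isAlgebraic_sin_pi_div (n : ℕ) : IsAlgebraic ℚ (Real.sin (Real.pi / n)) := by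
  have h := (Real.isAlgebraic_sin_rat_mul_pi (1 / n)).extendScalars (S := ℚ) (algebraMap ℤ ℚ).injective_int
  push_cast at h
  rwa [one_div_mul_eq_div] at h

theorem isAlgebraic_cot_pi_div (n : ℕ) : IsAlgebraic ℚ (Real.cot (Real.pi / n)) := by
  rw [Real.cot_eq_cos_div_sin]
  exact (isAlgebraic_cos_pi_div n).mul (isAlgebraic_sin_pi_div n).inv

theorem IsAlgebraic.real_sqrt {x : ℝ} (hx : IsAlgebraic ℚ x) : IsAlgebraic ℚ (Real.sqrt x) := by
  rcases le_total 0 x with h | h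
  · exact IsAlgebraic.of_pow two_pos (by rwa [Real.sq_sqrt h])
  · rw [Real.sqrt_eq_zero_of_nonpos h]
    exact isAlgebraic_zero

theorem isAlgebraic_triangleMu (a b c : ℕ) : IsAlgebraic ℚ (triangleMu a b c) := by
  have hl : IsAlgebraic ℚ (triangleLam a b c) :=
    (((isAlgebraic_cos_pi_div a).mul (isAlgebraic_cos_pi_div b)).add
      (isAlgebraic_cos_pi_div c)).mul
      ((isAlgebraic_sin_pi_div a).mul (isAlgebraic_sin_pi_div b)).inv
  exact hl.add ((hl.pow 2).sub isAlgebraic_one).real_sqrt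

theorem isAlgebraic_triangleZc (a b c : ℕ) : IsAlgebraic ℚ (triangleZc a b c) := by
  have hμ := isAlgebraic_triangleMu a b c
  have h2 : IsAlgebraic ℚ (2 : ℝ) := by
    exact_mod_cast isAlgebraic_natCast (R := ℚ) (A := ℝ) 2
  have hre : IsAlgebraic ℚ (triangleZcRe a b c) :=
    ((hμ.pow 2).sub isAlgebraic_one).mul (h2.mul ((isAlgebraic_cot_pi_div a).add
      (hμ.mul (isAlgebraic_cot_pi_div b)))).inv
  have him : IsAlgebraic ℚ (triangleZcImSq a b c) :=
    ((isAlgebraic_one.mul (isAlgebraic_sin_pi_div a).inv).pow 2).sub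
      ((hre.sub (isAlgebraic_cot_pi_div a)).pow 2)
  have hI : IsAlgebraic ℚ Complex.I := IsAlgebraic.of_pow two_pos (by
    rw [Complex.I_sq]; exact isAlgebraic_one.neg)
  exact (hre.algebraMap (A := ℂ)).add (hI.mul (him.real_sqrt.algebraMap (A := ℂ)))

end Formulas

/-! ### Fixed points in the upper half-plane -/

/-- An element of `PSL₂(ℝ)` given by a matrix has a single fixed point `x + iy`, as soon as
`x + iy` is a root of the fixed point equation. -/
theorem pslFixedPoints_mk (S : SL(2, ℝ)) (x y : ℝ) (hy : 0 < y) (hr : S 1 0 ≠ 0)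
    (h1 : 2 * S 1 0 * x = S 0 0 - S 1 1) (h2 : S 1 0 * (x ^ 2 + y ^ 2) = -S 0 1) :
    pslFixedPoints (QuotientGroup.mk S : PSL(2, ℝ)) = {(x : ℂ) + Complex.I * (y : ℂ)} := by
  have key : ∀ z : ℍ, S • z = z ↔ z.re = x ∧ z.im = y := by
    intro z
    have hz := z.im_pos
    have hd : ((S 1 0 : ℝ) : ℂ) * z + ((S 1 1 : ℝ) : ℂ) ≠ 0 := by
      intro h
      have := congrArg Complex.im h
      simp at this
      exact this.elim hr hz.ne'
    rw [UpperHalfPlane.ext_iff, UpperHalfPlane.coe_specialLinearGroup_apply]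
    simp only [Algebra.algebraMap_self, RingHom.id_apply]
    rw [div_eq_iff hd, Complex.ext_iff]
    simp only [Complex.add_re, Complex.mul_re, Complex.ofReal_re, UpperHalfPlane.coe_re,
      Complex.ofReal_im, UpperHalfPlane.coe_im, Complex.add_im, Complex.mul_im]
    constructor
    -- The imaginary part of the quadratic, divided by `z.im`, determines the real part of `z`; the
    -- real part of the quadratic then determines `z.im ^ 2`.
    · rintro ⟨hre, him⟩
      have hx : z.re = x := by
        apply mul_left_cancel₀ (mul_ne_zero (mul_ne_zero two_ne_zero hr) hz.ne')
        linear_combination -him - z.im * h1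
      refine ⟨hx, ?_⟩
      rw [hx] at hre
      have hsq : z.im ^ 2 = y ^ 2 := by
        apply mul_left_cancel₀ hr
        linear_combination hre - h2 + x * h1
      exact (sq_eq_sq₀ hz.le hy.le).1 hsq
    · rintro ⟨rfl, rfl⟩
      constructor
      · linear_combination -z.re * h1 + h2
      · linear_combination -z.im * h1
  ext w
  simp only [pslFixedPoints, Set.mem_ofPred_eq, toPGL_mk_smul, Set.mem_singleton_iff, key]
  constructor
  · rintro ⟨z, rfl, rfl, rfl⟩
    rw [mul_comm]
    exact (Complex.re_add_im (z : ℂ)).symm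
  · rintro rfl
    exact ⟨⟨(x : ℂ) + Complex.I * y, by simpa using hy⟩, rfl, by
      simp [UpperHalfPlane.re], by simp [UpperHalfPlane.im]⟩

/-! ### Reflections from elements of square one -/

section Clifford

variable {R : Type*} [Ring R] [Algebra ℝ R]

/-- An element with "trace" `2 cos (π / n)` and "determinant" `1` has `n`-th power `-1`. -/
theorem pow_eq_neg_one_of_sq_eq {u : R} {n : ℕ} (hn : 2 ≤ n)
    (hu : u * u = (2 * Real.cos (Real.pi / n)) • u - 1) : u ^ n = -1 := by
  have hn0 : (n : ℝ) ≠ 0 := by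
    have : n ≠ 0 := by lia
    exact_mod_cast this
  have hs := (sin_pi_div_pos hn).ne'
  obtain ⟨θ, hθ⟩ : ∃ θ, θ = Real.pi / n := ⟨_, rfl⟩
  rw [← hθ] at hu hs
  -- At `k = n` the angle `kθ` is `π`, so the right side reduces to `-sin θ`.
  have key : ∀ k : ℕ, Real.sin θ • u ^ k = Real.sin (k * θ) • u - Real.sin (k * θ - θ) • 1 := by
    intro k
    induction k with
    | zero => simp
    | succ k ih =>
      have h1 : ((k + 1 : ℕ) : ℝ) * θ = k * θ + θ := by push_cast; ring
      have h2 : ((k + 1 : ℕ) : ℝ) * θ - θ = k * θ := by push_cast; ring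
      have h3 : Real.sin (k * θ + θ) =
          2 * Real.cos θ * Real.sin (k * θ) - Real.sin (k * θ - θ) := by
        rw [Real.sin_add, Real.sin_sub]; ring
      rw [pow_succ, ← smul_mul_assoc, ih, h2, h1, h3, sub_mul, smul_mul_assoc, smul_mul_assoc, hu,
        one_mul]
      module
  have h := key n
  rw [show (n : ℝ) * θ = Real.pi by rw [hθ]; field_simp, Real.sin_pi, Real.sin_pi_sub, zero_smul,
    zero_sub, ← smul_neg] at h
  exact smul_right_injective R hs h

/-- Because the anticommutator is scalar, `u = -(xy)` satisfies `u² = 2cos(π/n)u - 1`. -/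
theorem neg_mul_pow_eq_neg_one {x y : R} {n : ℕ} (hn : 2 ≤ n) (hx : x * x = 1) (hy : y * y = 1)
    (hxy : x * y + y * x = (-(2 * Real.cos (Real.pi / n))) • 1) : (-(x * y)) ^ n = -1 := by
  apply pow_eq_neg_one_of_sq_eq hn
  have h1 : y * x = (-(2 * Real.cos (Real.pi / n))) • 1 - x * y := by rw [← hxy]; abel
  calc -(x * y) * -(x * y) = x * (y * x) * y := by simp only [neg_mul_neg, mul_assoc]
    _ = (-(2 * Real.cos (Real.pi / n))) • (x * y) - x * x * (y * y) := by
      rw [h1]; simp only [mul_sub, sub_mul, mul_assoc, mul_smul_comm, smul_mul_assoc, one_mul]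
    _ = _ := by rw [hx, hy, mul_one]; module

/-- Reflection in an element of square `1`. -/
noncomputable def conjReflection (x : R) : Module.End ℝ R :=
  -(LinearMap.mulLeft ℝ x * LinearMap.mulRight ℝ x)

@[simp] theorem conjReflection_apply (x y : R) : conjReflection x y = -(x * (y * x)) := rfl

theorem conjReflection_mul_self {x : R} (hx : x * x = 1) :
    conjReflection x * conjReflection x = 1 := by
  ext y
  have : x * (x * (y * x) * x) = (x * x) * y * (x * x) := by simp only [mul_assoc]
  simp [this, hx]

theorem conjReflection_mul_pow_apply (x y z : R) (n : ℕ) :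
    ((conjReflection x * conjReflection y) ^ n) z = (-(x * y)) ^ n * z * (-(y * x)) ^ n := by
  induction n generalizing z with
  | zero => simp
  | succ n ih =>
    rw [pow_succ, Module.End.mul_apply, ih, pow_succ, pow_succ' (-(y * x))]
    simp [mul_assoc]

theorem conjReflection_mul_pow {x y : R} {n : ℕ} (hn : 2 ≤ n) (hx : x * x = 1) (hy : y * y = 1)
    (hxy : x * y + y * x = (-(2 * Real.cos (Real.pi / n))) • 1) :
    (conjReflection x * conjReflection y) ^ n = 1 := by
  ext z
  rw [conjReflection_mul_pow_apply, neg_mul_pow_eq_neg_one hn hx hy hxy,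
    neg_mul_pow_eq_neg_one hn hy hx (by rw [add_comm, hxy])]
  simp

/-- This is the root reflection formula of the Tits argument, with the elements of square one
serving as roots. -/
theorem conjReflection_root {x y : R} {t : ℝ} (hy : y * y = 1)
    (hxy : x * y + y * x = (-(2 * t)) • 1) : conjReflection y x = x + (2 * t) • y := by
  have h1 : x * y = (-(2 * t)) • 1 - y * x := by rw [← hxy]; abel
  rw [conjReflection_apply, h1, mul_sub, ← mul_assoc, hy, mul_smul_comm]
  simp only [mul_one, one_mul]
  module

end Clifford

/-! ### The embedding into PSL₂(ℝ) -/

/-- The conjugation action of `PSL₂(ℝ)` on `2 × 2` matrices. -/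
noncomputable def pslConj : PSL(2, ℝ) →* Module.End ℝ (Matrix (Fin 2) (Fin 2) ℝ) :=
  QuotientGroup.lift (Subgroup.center SL(2, ℝ))
    { toFun := fun S => LinearMap.mulLeft ℝ (S : Matrix (Fin 2) (Fin 2) ℝ) *
        LinearMap.mulRight ℝ ((S⁻¹ : SL(2, ℝ)) : Matrix (Fin 2) (Fin 2) ℝ)
      map_one' := by ext1 Y; simp
      map_mul' := fun S T => by
        ext1 Y
        simp [mul_assoc] }
    (by
      intro S hS
      obtain ⟨r, -, hr⟩ := Matrix.SpecialLinearGroup.mem_center_iff.1 hS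
      ext1 Y
      have hc : (S : Matrix (Fin 2) (Fin 2) ℝ) * Y = Y * S := by
        rw [← hr]
        exact (Matrix.scalar_commute r (fun _ => Commute.all _ _) Y).eq
      have hi : (S : Matrix (Fin 2) (Fin 2) ℝ) * ((S⁻¹ : SL(2, ℝ)) : Matrix _ _ ℝ) = 1 := by
        rw [← Matrix.SpecialLinearGroup.coe_mul, mul_inv_cancel, Matrix.SpecialLinearGroup.coe_one]
      show (S : Matrix (Fin 2) (Fin 2) ℝ) * (Y * ((S⁻¹ : SL(2, ℝ)) : Matrix _ _ ℝ)) = Y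
      rw [← mul_assoc, hc, mul_assoc, hi, mul_one])

theorem pslConj_mk_apply (S : SL(2, ℝ)) (Y : Matrix (Fin 2) (Fin 2) ℝ) :
    pslConj (QuotientGroup.mk S) Y =
      (S : Matrix (Fin 2) (Fin 2) ℝ) * (Y * ((S⁻¹ : SL(2, ℝ)) : Matrix _ _ ℝ)) := rfl

theorem psl_mk_eq_one {S : SL(2, ℝ)} (hS : (S : Matrix (Fin 2) (Fin 2) ℝ) = -1) :
    (QuotientGroup.mk S : PSL(2, ℝ)) = 1 := by
  rw [QuotientGroup.eq_one_iff, Matrix.SpecialLinearGroup.mem_center_iff]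
  exact ⟨-1, by simp, by rw [hS, map_neg, map_one]⟩

/-- The three reflection matrices: reflections in the sides of the hyperbolic triangle with vertices
`z_a, z_b, z_c`. -/
noncomputable def triangleReflection (a b c : ℕ) : Fin 3 → Matrix (Fin 2) (Fin 2) ℝ :=
  ![!![-1, 0; 0, 1],
    !![Real.cos (Real.pi / a), Real.sin (Real.pi / a);
      Real.sin (Real.pi / a), -Real.cos (Real.pi / a)],
    !![Real.cos (Real.pi / b), -(triangleMu a b c * Real.sin (Real.pi / b));
      -(Real.sin (Real.pi / b) / triangleMu a b c), -Real.cos (Real.pi / b)]]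

theorem triangleReflection_zero_one (a b c : ℕ) :
    triangleReflection a b c 0 * triangleReflection a b c 1 +
    triangleReflection a b c 1 * triangleReflection a b c 0 =
      (-(2 * Real.cos (Real.pi / a))) • 1 := by
  ext i j
  fin_cases i <;> fin_cases j <;> simp [triangleReflection] <;> ring

theorem triangleReflection_two_zero (a b c : ℕ) :
    triangleReflection a b c 2 * triangleReflection a b c 0 +
    triangleReflection a b c 0 * triangleReflection a b c 2 =
      (-(2 * Real.cos (Real.pi / b))) • 1 := by
  ext i j
  fin_cases i <;> fin_cases j <;> simp [triangleReflection] <;> ring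

namespace IsHyperbolicTriple

variable {a b c : ℕ} (h : IsHyperbolicTriple a b c)
include h

theorem mu_ne_zero : triangleMu a b c ≠ 0 := by have := h.one_lt_mu; positivity

theorem reflection_mul_self (i : Fin 3) :
    triangleReflection a b c i * triangleReflection a b c i = 1 := by
  have hμ := h.mu_ne_zero
  have hA := Real.sin_sq_add_cos_sq (Real.pi / a)
  have hB := Real.sin_sq_add_cos_sq (Real.pi / b)
  fin_cases i
  · ext i j
    fin_cases i <;> fin_cases j <;> simp [triangleReflection]
  · ext i j
    fin_cases i <;> fin_cases j <;> simp [triangleReflection] <;>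
      first | ring1 | linear_combination hA
  · ext i j
    fin_cases i <;> fin_cases j <;> simp [triangleReflection] <;>
      field_simp <;> first | ring1 | linear_combination hB

theorem reflection_det (i : Fin 3) : (triangleReflection a b c i).det = -1 := by
  have hμ := h.mu_ne_zero
  have hA := Real.sin_sq_add_cos_sq (Real.pi / a)
  have hB := Real.sin_sq_add_cos_sq (Real.pi / b)
  fin_cases i
  · simp [triangleReflection, Matrix.det_fin_two]
  · simp [triangleReflection, Matrix.det_fin_two]
    linear_combination -hA
  · simp [triangleReflection, Matrix.det_fin_two]
    field_simp
    linear_combination -hB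

/-- This is the one mixed relation that depends on `μ`: it amounts to `μ + 1/μ = 2λ`. -/
theorem reflection_one_two : triangleReflection a b c 1 * triangleReflection a b c 2 +
    triangleReflection a b c 2 * triangleReflection a b c 1 =
      (-(2 * Real.cos (Real.pi / c))) • 1 := by
  have hμ := h.mu_ne_zero
  have hr := h.mu_relation
  ext i j
  fin_cases i <;> fin_cases j <;> simp [triangleReflection] <;>
    field_simp <;> first | ring1 | linear_combination -hr

theorem reflection_anticomm (i j : Fin 3) : triangleReflection a b c i * triangleReflection a b c j +
    triangleReflection a b c j * triangleReflection a b c i =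
      (-(2 * Real.cos
        (Real.pi / triangleCoxeterMatrix a b c h.1 h.2.1 h.2.2.1 i j))) • 1 := by
  have hd : ∀ i, triangleReflection a b c i * triangleReflection a b c i +
      triangleReflection a b c i * triangleReflection a b c i =
        (-(2 * Real.cos (Real.pi / (1 : ℕ)))) • 1 := by
    intro i
    rw [h.reflection_mul_self, Nat.cast_one, div_one, Real.cos_pi]
    module
  fin_cases i <;> fin_cases j
  · exact hd 0
  · exact (triangleReflection_zero_one a b c)
  · exact (add_comm _ _).trans (triangleReflection_two_zero a b c)
  · exact (add_comm _ _).trans (triangleReflection_zero_one a b c)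
  · exact hd 1
  · exact h.reflection_one_two
  · exact (triangleReflection_two_zero a b c)
  · exact (add_comm _ _).trans h.reflection_one_two
  · exact hd 2

/-- The sides of the triangle lie in a common open half-space. -/
theorem exists_functional_pos : ∃ f : Matrix (Fin 2) (Fin 2) ℝ →ₗ[ℝ] ℝ,
    ∀ i, 0 < f (triangleReflection a b c i) := by
  have hμ := h.one_lt_mu
  have sa := sin_pi_div_pos h.1
  have sb := sin_pi_div_pos h.2.1
  have ca := Real.cos_le_one (Real.pi / a)
  have cb := Real.cos_le_one (Real.pi / b)
  set μ := triangleMu a b c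
  have hm : 0 < μ ^ 2 - 1 := by nlinarith
  -- The functional is `Y ↦ |z|² Y₁₀ - 2 Re(z) Y₀₀ - Y₀₁` for a point `z` inside the triangle, with
  -- `|z|²` midway between `1` and `μ²` and `Re z = N/2`. Its values on the three sides are `N`, `p
  -- - N cos(π/a)` and `q - N cos(π/b)`, so `N = min p q / 2` works.
  obtain ⟨p, hp⟩ : ∃ p, p = Real.sin (Real.pi / a) * ((μ ^ 2 - 1) / 2) := ⟨_, rfl⟩
  obtain ⟨q, hq⟩ : ∃ q, q = Real.sin (Real.pi / b) * ((μ ^ 2 - 1) / (2 * μ)) := ⟨_, rfl⟩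
  have hp0 : 0 < p := by rw [hp]; positivity
  have hq0 : 0 < q := by rw [hq]; positivity
  have hN : 0 < min p q / 2 := half_pos (lt_min hp0 hq0)
  have hNp := min_le_left p q
  have hNq := min_le_right p q
  set N := min p q / 2 with hNdef
  refine ⟨((1 + μ ^ 2) / 2) • Matrix.entryLinearMap ℝ ℝ 1 0 - Matrix.entryLinearMap ℝ ℝ 0 1 -
    N • Matrix.entryLinearMap ℝ ℝ 0 0, fun i => ?_⟩
  fin_cases i
  · simpa [triangleReflection] using hN
  · simp [triangleReflection]
    have e : (1 + μ ^ 2) / 2 * Real.sin (Real.pi / a) = p + Real.sin (Real.pi / a) := by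
      rw [hp]; ring
    rw [e]
    nlinarith [mul_le_mul_of_nonneg_left ca hN.le]
  · simp [triangleReflection]
    have e : (1 + μ ^ 2) / 2 * (Real.sin (Real.pi / b) / μ) = μ * Real.sin (Real.pi / b) - q := by
      have : μ ≠ 0 := by positivity
      rw [hq]; field_simp; ring
    change (1 + μ ^ 2) / 2 * (Real.sin (Real.pi / b) / μ) + N * Real.cos (Real.pi / b) <
      μ * Real.sin (Real.pi / b)
    rw [e]
    nlinarith [mul_le_mul_of_nonneg_left cb hN.le]

/-- The product of two reflections (up to sign), in `SL₂(ℝ)`. -/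
noncomputable def rotation (i j : Fin 3) : SL(2, ℝ) :=
  ⟨-(triangleReflection a b c i * triangleReflection a b c j), by
    rw [Matrix.det_neg, Matrix.det_mul, h.reflection_det, h.reflection_det]
    simp⟩

theorem coe_rotation (i j : Fin 3) : (h.rotation i j : Matrix (Fin 2) (Fin 2) ℝ) =
    -(triangleReflection a b c i * triangleReflection a b c j) := rfl

theorem rotation_inv (i j : Fin 3) : (h.rotation i j)⁻¹ = h.rotation j i := by
  rw [inv_eq_iff_mul_eq_one]
  ext1
  rw [Matrix.SpecialLinearGroup.coe_mul, coe_rotation, coe_rotation, neg_mul_neg, mul_assoc,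
    ← mul_assoc _ _ (triangleReflection a b c i), h.reflection_mul_self, one_mul,
    h.reflection_mul_self, Matrix.SpecialLinearGroup.coe_one]

/-- The inverse of `-XᵢXⱼ` is `-XⱼXᵢ`, so the signs cancel in the conjugation. -/
theorem pslConj_rotation (i j : Fin 3) : pslConj (QuotientGroup.mk (h.rotation i j)) =
    conjReflection (triangleReflection a b c i) * conjReflection (triangleReflection a b c j) := by
  ext1 Y
  rw [pslConj_mk_apply, rotation_inv, coe_rotation, coe_rotation]
  simp [mul_assoc]

theorem rotation_pow (i j : Fin 3) (n : ℕ) (hn : 2 ≤ n)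
    (hij : triangleReflection a b c i * triangleReflection a b c j +
      triangleReflection a b c j * triangleReflection a b c i =
        (-(2 * Real.cos (Real.pi / n))) • 1) :
    (QuotientGroup.mk (h.rotation i j) : PSL(2, ℝ)) ^ n = 1 := by
  rw [← QuotientGroup.mk_pow]
  apply psl_mk_eq_one
  rw [Matrix.SpecialLinearGroup.coe_pow, coe_rotation]
  exact neg_mul_pow_eq_neg_one hn (h.reflection_mul_self i) (h.reflection_mul_self j) hij

/-- The homomorphism from the triangle group to `PSL₂(ℝ)`. -/
noncomputable def toPSL : TriangleGroup a b c →* PSL(2, ℝ) :=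
  TriangleGroup.lift (QuotientGroup.mk (h.rotation 0 1)) (QuotientGroup.mk (h.rotation 2 0))
    (QuotientGroup.mk (h.rotation 1 2))
    (h.rotation_pow _ _ _ h.1 (triangleReflection_zero_one a b c))
    (h.rotation_pow _ _ _ h.2.1 (triangleReflection_two_zero a b c))
    (h.rotation_pow _ _ _ h.2.2.1 h.reflection_one_two)
    (by
      rw [← QuotientGroup.mk_mul, ← QuotientGroup.mk_mul]
      -- The product of the three matrices is `-1`, so the relation holds only after passing to
      -- PSL₂(ℝ).
      apply psl_mk_eq_one
      rw [Matrix.SpecialLinearGroup.coe_mul, Matrix.SpecialLinearGroup.coe_mul, coe_rotation,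
        coe_rotation, coe_rotation]
      have assoc : ∀ x y z : Matrix (Fin 2) (Fin 2) ℝ,
          -(x * y) * -(y * z) * -(z * x) = -(x * ((y * y) * (z * z)) * x) := by
        intro x y z
        simp only [neg_mul, mul_neg, neg_neg, mul_assoc]
      rw [assoc, h.reflection_mul_self, h.reflection_mul_self, mul_one, mul_one,
        h.reflection_mul_self])

theorem toPSL_injective : Function.Injective h.toPSL := by
  have hM := triangleCoxeterMatrix_ne_zero h.1 h.2.1 h.2.2.1
  let cs := (triangleCoxeterMatrix a b c h.1 h.2.1 h.2.2.1).toCoxeterSystem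
  have hl : (triangleCoxeterMatrix a b c h.1 h.2.1 h.2.2.1).IsLiftable
      (fun i => conjReflection (triangleReflection a b c i)) := by
    have hr := h.reflection_mul_self
    apply triangleCoxeterMatrix_isLiftable
    · exact fun i => conjReflection_mul_self (hr i)
    · exact conjReflection_mul_pow h.1 (hr 0) (hr 1) (triangleReflection_zero_one a b c)
    · exact conjReflection_mul_pow h.2.1 (hr 2) (hr 0) (triangleReflection_two_zero a b c)
    · exact conjReflection_mul_pow h.2.2.1 (hr 1) (hr 2) h.reflection_one_two
  let ρ := cs.lift ⟨_, hl⟩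
  have hρ : ∀ i, ρ (cs.simple i) = conjReflection (triangleReflection a b c i) :=
    cs.lift_apply_simple hl
  -- Through this identity the kernel of `toPSL` maps into the kernel of the faithful `ρ`.
  have hcomp : pslConj.comp h.toPSL = ρ.comp (TriangleGroup.toCoxeter h.1 h.2.1 h.2.2.1) := by
    apply TriangleGroup.hom_ext
    · rw [MonoidHom.comp_apply, MonoidHom.comp_apply, TriangleGroup.toCoxeter_delta_a, map_mul,
        toPSL, TriangleGroup.lift_delta_a, pslConj_rotation]
      exact (congrArg₂ _ (hρ 0) (hρ 1)).symm
    · rw [MonoidHom.comp_apply, MonoidHom.comp_apply, TriangleGroup.toCoxeter_delta_b, map_mul,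
        toPSL, TriangleGroup.lift_delta_b, pslConj_rotation]
      exact (congrArg₂ _ (hρ 2) (hρ 0)).symm
  obtain ⟨f, hf⟩ := h.exists_functional_pos
  rw [injective_iff_map_eq_one]
  intro g hg
  apply (injective_iff_map_eq_one _).1 (TriangleGroup.toCoxeter_injective h.1 h.2.1 h.2.2.1)
  apply cs.geometric_representation_injective hM ρ (triangleReflection a b c) _ f hf
  · have := DFunLike.congr_fun hcomp g
    rw [MonoidHom.comp_apply, MonoidHom.comp_apply, hg, map_one] at this
    exact this.symm
  · intro s t
    rw [hρ]
    exact conjReflection_root (h.reflection_mul_self t) (h.reflection_anticomm s t)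

/-! ### Matrices and fixed points of the generators -/

theorem coe_rotation_zero_one : (h.rotation 0 1 : Matrix (Fin 2) (Fin 2) ℝ) =
    !![Real.cos (Real.pi / a), Real.sin (Real.pi / a);
      -Real.sin (Real.pi / a), Real.cos (Real.pi / a)] := by
  rw [coe_rotation]
  ext i j
  fin_cases i <;> fin_cases j <;> simp [triangleReflection]

theorem coe_rotation_two_zero : (h.rotation 2 0 : Matrix (Fin 2) (Fin 2) ℝ) =
    !![Real.cos (Real.pi / b), triangleMu a b c * Real.sin (Real.pi / b);
      -Real.sin (Real.pi / b) / triangleMu a b c, Real.cos (Real.pi / b)] := by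
  rw [coe_rotation]
  ext i j
  fin_cases i <;> fin_cases j <;> simp [triangleReflection, neg_div]

theorem pslFixedPoints_rotation_zero_one :
    pslFixedPoints (QuotientGroup.mk (h.rotation 0 1) : PSL(2, ℝ)) = {Complex.I} := by
  have sa := (sin_pi_div_pos h.1).ne'
  have := pslFixedPoints_mk (h.rotation 0 1) 0 1 one_pos
  simpa [h.coe_rotation_zero_one, sa] using this

theorem pslFixedPoints_rotation_two_zero :
    pslFixedPoints (QuotientGroup.mk (h.rotation 2 0) : PSL(2, ℝ)) =
      {(triangleMu a b c : ℂ) * Complex.I} := by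
  have sb := (sin_pi_div_pos h.2.1).ne'
  have hμ := h.one_lt_mu
  have hμ0 := h.mu_ne_zero
  have := pslFixedPoints_mk (h.rotation 2 0) 0 (triangleMu a b c) (by linarith)
    (by simp [h.coe_rotation_two_zero, sb, hμ0]) (by simp [h.coe_rotation_two_zero])
    (by simp [h.coe_rotation_two_zero]; field_simp)
  rw [this, mul_comm]
  simp

theorem pslFixedPoints_rotation_one_two :
    pslFixedPoints (QuotientGroup.mk (h.rotation 1 2) : PSL(2, ℝ)) = {triangleZc a b c} := by
  have sa := (sin_pi_div_pos h.1).ne'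
  have hμ := h.mu_ne_zero
  have hD := h.denom_pos.ne'
  have hx := h.zcRe_relation
  have hy := Real.sq_sqrt h.zcImSq_pos.le
  rw [h.zcImSq_eq_add] at hy
  have h10 : h.rotation 1 2 1 0 = -((Real.sin (Real.pi / b) * Real.cos (Real.pi / a) +
      triangleMu a b c * (Real.sin (Real.pi / a) * Real.cos (Real.pi / b))) /
        triangleMu a b c) := by
    simp [coe_rotation, triangleReflection]
    field_simp
    ring
  have h01 : h.rotation 1 2 0 1 = Real.cos (Real.pi / a) * (triangleMu a b c *
      Real.sin (Real.pi / b)) + Real.sin (Real.pi / a) * Real.cos (Real.pi / b) := by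
    simp [coe_rotation, triangleReflection]
    ring
  have hdiff : h.rotation 1 2 0 0 - h.rotation 1 2 1 1 =
      -((triangleMu a b c ^ 2 - 1) * (Real.sin (Real.pi / a) * Real.sin (Real.pi / b)) /
        triangleMu a b c) := by
    simp [coe_rotation, triangleReflection]
    field_simp
    ring
  have h1 : 2 * h.rotation 1 2 1 0 * triangleZcRe a b c =
      h.rotation 1 2 0 0 - h.rotation 1 2 1 1 := by
    rw [hdiff, h10, ← hx]
    ring
  refine pslFixedPoints_mk (h.rotation 1 2) (triangleZcRe a b c) _
    (Real.sqrt_pos.2 h.zcImSq_pos) ?_ h1 ?_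
  · rw [h10]
    exact neg_ne_zero.2 (div_ne_zero hD hμ)
  · rw [h.zcImSq_eq_add, hy]
    -- The circle equation cancels the square of the real part; the remaining linear term is given
    -- by `h1`.
    have e : h.rotation 1 2 1 0 * (triangleZcRe a b c ^ 2 + (1 + 2 * triangleZcRe a b c *
        (Real.cos (Real.pi / a) / Real.sin (Real.pi / a)) - triangleZcRe a b c ^ 2)) =
        h.rotation 1 2 1 0 + 2 * h.rotation 1 2 1 0 * triangleZcRe a b c *
          (Real.cos (Real.pi / a) / Real.sin (Real.pi / a)) := by ring
    rw [e, h1, hdiff, h10, h01]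
    field_simp
    ring

end IsHyperbolicTriple

theorem proposition3p2 (a b c : ℕ) (habc : IsHyperbolicTriple a b c) :
    -- the closed formulas below make sense
    1 < triangleLam a b c ∧
    0 < Real.cot (Real.pi / a) + triangleMu a b c * Real.cot (Real.pi / b) ∧
    0 < triangleZcImSq a b c ∧
    -- the embedding
    (∃ φ : TriangleGroup a b c →* PSL(2, ℝ),
      Function.Injective φ ∧
      IsClassOfMatrix (φ (triangleDelta a b c TriangleGen.a))
        !![Real.cos (Real.pi / a), Real.sin (Real.pi / a);
           -Real.sin (Real.pi / a), Real.cos (Real.pi / a)] ∧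
      IsClassOfMatrix (φ (triangleDelta a b c TriangleGen.b))
        !![Real.cos (Real.pi / b), triangleMu a b c * Real.sin (Real.pi / b);
           -Real.sin (Real.pi / b) / triangleMu a b c, Real.cos (Real.pi / b)] ∧
      -- the fixed points
      pslFixedPoints (φ (triangleDelta a b c TriangleGen.a)) = {Complex.I} ∧
      pslFixedPoints (φ (triangleDelta a b c TriangleGen.b)) =
        {(triangleMu a b c : ℂ) * Complex.I} ∧
      pslFixedPoints (φ (triangleDelta a b c TriangleGen.c)) = {triangleZc a b c}) ∧
    IsAlgebraic ℚ (triangleZc a b c) := by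
  refine ⟨habc.one_lt_lam, habc.cot_pos, habc.zcImSq_pos,
    ⟨habc.toPSL, habc.toPSL_injective, ?_, ?_, ?_, ?_, ?_⟩, isAlgebraic_triangleZc a b c⟩
  · exact ⟨habc.rotation 0 1, habc.coe_rotation_zero_one, (TriangleGroup.lift_delta_a ..).symm⟩
  · exact ⟨habc.rotation 2 0, habc.coe_rotation_two_zero, (TriangleGroup.lift_delta_b ..).symm⟩
  · rw [IsHyperbolicTriple.toPSL, TriangleGroup.lift_delta_a]
    exact habc.pslFixedPoints_rotation_zero_one
  · rw [IsHyperbolicTriple.toPSL, TriangleGroup.lift_delta_b]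
    exact habc.pslFixedPoints_rotation_two_zero
  · rw [IsHyperbolicTriple.toPSL, TriangleGroup.lift_delta_c]
    exact habc.pslFixedPoints_rotation_one_two
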